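/- Let $\mathcal D$ be the usual dyadic lattice of half-open intervals $I=[j2^{-k},(j+1)2^{-k})$ ($j,k\in\mathbb Z$) on the line; $I_+$ and $I_-$ denote the right and left halves of $I$, and $h_I=|I|^{-1/2}(\mathbf 1_{I_+}-\mathbf 1_{I_-})$ is the Haar function of $I$. Call $I\in\mathcal D$ even if $|I|=2^{-2m}$ for some $m\in\mathbb Z$, and odd otherwise. Let $T_1$ be the dyadic shift in the variable $x$ given by $T_1h_I=h_{I_+}-h_{I_-}$ if $I$ is even and $T_1h_I=0$ if $I$ is odd, and let $T_2$ be the same operator acting in the variable $y$. For a (real or complex valued) locally integrable function $b$ on $\mathbb R^2$ write $(b,h_I\otimes h_J)=\int_{\mathbb R^2} b(x,y)\,h_I(x)h_J(y)\,dx\,dy$, and consider the repeated commutator $$\mathcal T^b=[T_2,[T_1,b]]=T_2T_1b-T_2bT_1-T_1bT_2+bT_1T_2 ,$$ where $b$ also denotes multiplication by $b$. It is defined on finite linear combinations $f$ of the functions $h_I\otimes h_J$, with $\mathcal T^bf$ understood through its Haar coefficients (the outer shifts act on Haar series term by term). We say that $\mathcal T^b$ is bounded on $L^2(\mathbb R^2)$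 if there is a bounded linear operator on $L^2(\mathbb R^2)$, again denoted $\mathcal T^b$, that has these Haar coefficients on every such $f$; $\|\mathcal T^b\|$ is its operator norm. **Theorem.** If $\mathcal T^b$ is bounded on $L^2(\mathbb R^2)$, then $b$ belongs to dyadic rectangular BMO: there is a finite constant $K$ with $$\sum_{I\in\mathcal D,\ I\subseteq I_0}\ \sum_{J\in\mathcal D,\ J\subseteq J_0}|(b,h_I\otimes h_J)|^2\le K\,|I_0|\,|J_0|\qquad\text{for all } I_0,J_0\in\mathcal D .$$ Moreover, one can take $K=C\|\mathcal T^b\|^2$ with a constant $C$ that does not depend on $b$, $I_0$, $J_0$. -/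

import Mathlib

open MeasureTheory
open scoped ENNReal NNReal

noncomputable section

/-- A dyadic interval of the line: the pair `(scale, index) = (k, j)` stands for
`[j 2⁻ᵏ, (j+1) 2⁻ᵏ)`. -/
@[ext]
structure DyadicInterval where
  scale : ℤ
  index : ℤ
  deriving DecidableEq

namespace DyadicInterval

/-- The length `|I| = 2⁻ᵏ`. -/
def length (I : DyadicInterval) : ℝ := (2 : ℝ) ^ (-I.scale)

/-- The underlying set of points. -/
def toSet (I : DyadicInterval) : Set ℝ :=
  Set.Ico ((I.index : ℝ) * I.length) (((I.index : ℝ) + 1) * I.length)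

/-- `I` is even if `|I| = 2⁻²ᵐ` for some integer `m`. -/
def IsEven (I : DyadicInterval) : Prop := Even I.scale

instance (I : DyadicInterval) : Decidable I.IsEven :=
  inferInstanceAs (Decidable (Even I.scale))

/-- The right half `I₊` of `I`. -/
def plus (I : DyadicInterval) : DyadicInterval := ⟨I.scale + 1, 2 * I.index + 1⟩

/-- The left half `I₋` of `I`. -/
def minus (I : DyadicInterval) : DyadicInterval := ⟨I.scale + 1, 2 * I.index⟩

/-- The dyadic parent `Î` of `I` (integer division rounds down). -/
def parent (I : DyadicInterval) : DyadicInterval := ⟨I.scale - 1, I.index / 2⟩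

/-- The sign `s(I, Î)`: it is `1` if `I = Î₊` and `-1` if `I = Î₋`. -/
def sign (I : DyadicInterval) : ℤ := if I = I.parent.plus then 1 else -1

/-- The `L²`-normalized Haar function `h_I = |I|^{-1/2} (1_{I₊} - 1_{I₋})`. -/
def haar (I : DyadicInterval) (x : ℝ) : ℝ :=
  (Real.sqrt I.length)⁻¹ *
    (I.plus.toSet.indicator (fun _ => (1 : ℝ)) x - I.minus.toSet.indicator (fun _ => (1 : ℝ)) x)

end DyadicInterval

/-- A dyadic rectangle `R = I × J`. -/
abbrev DyadicRect : Type := DyadicInterval × DyadicInterval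

/-- The bi-parameter Haar function `h_R = h_I ⊗ h_J`. -/
def haarRect (R : DyadicRect) (p : ℝ × ℝ) : ℝ := R.1.haar p.1 * R.2.haar p.2

section Commutator

variable {𝕜 : Type*} [RCLike 𝕜]

/-- The Haar coefficient `(u, h_R) = ∫ u h_R` of a function `u` on the plane. -/
def haarCoeff (u : ℝ × ℝ → 𝕜) (R : DyadicRect) : 𝕜 := ∫ p, u p * ((haarRect R p : ℝ) : 𝕜)

/-- The function `∑ c_R h_R` given by a finite family of Haar coefficients. -/
def haarSum (c : DyadicRect →₀ 𝕜) (p : ℝ × ℝ) : 𝕜 :=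
  c.sum fun R a => a * ((haarRect R p : ℝ) : 𝕜)

/-- The shift `T₁` on finite Haar sums: linear, with
`T₁ (h_I ⊗ h_J) = (h_{I₊} - h_{I₋}) ⊗ h_J` if `I` is even, and `0` otherwise. -/
def shiftOne (c : DyadicRect →₀ 𝕜) : DyadicRect →₀ 𝕜 :=
  c.sum fun R a =>
    if R.1.IsEven then Finsupp.single (R.1.plus, R.2) a - Finsupp.single (R.1.minus, R.2) a
    else 0

/-- The shift `T₂` on finite Haar sums: the same operator in the second variable. -/
def shiftTwo (c : DyadicRect →₀ 𝕜) : DyadicRect →₀ 𝕜 :=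
  c.sum fun R a =>
    if R.2.IsEven then Finsupp.single (R.1, R.2.plus) a - Finsupp.single (R.1, R.2.minus) a
    else 0

/-- The shift `T₁` on arbitrary (formal) Haar series `∑ a_R h_R`. Collecting the coefficient of
`h_I ⊗ h_J` in `∑_{I even, J} a_{I × J} (h_{I₊} - h_{I₋}) ⊗ h_J` gives `s(I, Î) a_{Î × J}` when
`I` is odd, that is when `Î` is even, and `0` when `I` is even. -/
def shiftOneSeries (a : DyadicRect → 𝕜) (R : DyadicRect) : 𝕜 :=
  if R.1.parent.IsEven then (R.1.sign : 𝕜) * a (R.1.parent, R.2) else 0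

/-- The shift `T₂` on arbitrary (formal) Haar series. -/
def shiftTwoSeries (a : DyadicRect → 𝕜) (R : DyadicRect) : 𝕜 :=
  if R.2.parent.IsEven then (R.2.sign : 𝕜) * a (R.1, R.2.parent) else 0

/-- The Haar series of the product `b · f`, for `f` a finite Haar sum. -/
def mulSymbol (b : ℝ × ℝ → 𝕜) (c : DyadicRect →₀ 𝕜) : DyadicRect → 𝕜 :=
  haarCoeff fun p => b p * haarSum c p

/-- The Haar series of `[T₂, [T₁, b]] f = T₂ T₁ (b f) - T₂ (b T₁ f) - T₁ (b T₂ f) + b T₁ T₂ f`,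
for `f` a finite Haar sum. -/
def repeatedCommutator (b : ℝ × ℝ → 𝕜) (c : DyadicRect →₀ 𝕜) (R : DyadicRect) : 𝕜 :=
  shiftTwoSeries (shiftOneSeries (mulSymbol b c)) R
    - shiftTwoSeries (mulSymbol b (shiftOne c)) R
    - shiftOneSeries (mulSymbol b (shiftTwo c)) R
    + mulSymbol b (shiftOne (shiftTwo c)) R

/-! Helper facts: the two descriptions of the shifts agree on finite Haar sums, and finite Haar
sums are square integrable. -/

theorem DyadicInterval.eq_plus_iff (I K : DyadicInterval) :
    I = K.plus ↔ K = I.parent ∧ I.sign = 1 := by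
  obtain ⟨k, j⟩ := I
  obtain ⟨l, i⟩ := K
  unfold sign
  split_ifs with h <;>
    simp only [plus, parent, DyadicInterval.mk.injEq] at h ⊢ <;> grind

theorem DyadicInterval.eq_minus_iff (I K : DyadicInterval) :
    I = K.minus ↔ K = I.parent ∧ I.sign = -1 := by
  obtain ⟨k, j⟩ := I
  obtain ⟨l, i⟩ := K
  unfold sign
  split_ifs with h <;>
    simp only [plus, minus, parent, DyadicInterval.mk.injEq] at h ⊢ <;> grind

theorem DyadicInterval.sign_eq (I : DyadicInterval) : I.sign = 1 ∨ I.sign = -1 := by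
  unfold sign
  split_ifs <;> simp

theorem shiftOneSeries_coe (c : DyadicRect →₀ 𝕜) :
    shiftOneSeries (⇑c) = ⇑(shiftOne c) := by
  classical
  funext R
  obtain ⟨I, J⟩ := R
  have key : ∀ (S : DyadicRect) (a : 𝕜),
      (if S.1.IsEven then Finsupp.single (S.1.plus, S.2) a - Finsupp.single (S.1.minus, S.2) a
        else 0 : DyadicRect →₀ 𝕜) (I, J)
        = if S = (I.parent, J) then (if I.parent.IsEven then (I.sign : 𝕜) * a else 0) else 0 := by
    rintro ⟨K, L⟩ a
    by_cases hK : K.IsEven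
    · have h1 : K.plus = I ↔ K = I.parent ∧ I.sign = 1 := by
        rw [← I.eq_plus_iff K, eq_comm]
      have h2 : K.minus = I ↔ K = I.parent ∧ I.sign = -1 := by
        rw [← I.eq_minus_iff K, eq_comm]
      simp only [hK, if_true, Finsupp.sub_apply, Finsupp.single_apply, Prod.mk.injEq, h1, h2]
      by_cases hp : K = I.parent
      · subst hp
        by_cases hL : L = J <;> rcases I.sign_eq with hs | hs <;> simp [hL, hs, hK]
      · simp [hp]
    · by_cases hp : K = I.parent
      · subst hp
        simp [hK]
      · simp [hK, hp]
  rw [shiftOne, Finsupp.sum_apply]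
  simp only [key, Finsupp.sum]
  rw [Finset.sum_ite_eq']
  by_cases hm : (I.parent, J) ∈ c.support
  · simp [shiftOneSeries, hm]
  · have h0 : c (I.parent, J) = 0 := by simpa using hm
    simp [shiftOneSeries, h0]

theorem shiftTwoSeries_coe (c : DyadicRect →₀ 𝕜) :
    shiftTwoSeries (⇑c) = ⇑(shiftTwo c) := by
  classical
  funext R
  obtain ⟨J, I⟩ := R
  have key : ∀ (S : DyadicRect) (a : 𝕜),
      (if S.2.IsEven then Finsupp.single (S.1, S.2.plus) a - Finsupp.single (S.1, S.2.minus) a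
        else 0 : DyadicRect →₀ 𝕜) (J, I)
        = if S = (J, I.parent) then (if I.parent.IsEven then (I.sign : 𝕜) * a else 0) else 0 := by
    rintro ⟨L, K⟩ a
    by_cases hK : K.IsEven
    · have h1 : K.plus = I ↔ K = I.parent ∧ I.sign = 1 := by
        rw [← I.eq_plus_iff K, eq_comm]
      have h2 : K.minus = I ↔ K = I.parent ∧ I.sign = -1 := by
        rw [← I.eq_minus_iff K, eq_comm]
      simp only [hK, if_true, Finsupp.sub_apply, Finsupp.single_apply, Prod.mk.injEq, h1, h2]
      by_cases hp : K = I.parent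
      · subst hp
        by_cases hL : L = J <;> rcases I.sign_eq with hs | hs <;> simp [hL, hs, hK]
      · simp [hp]
    · by_cases hp : K = I.parent
      · subst hp
        simp [hK]
      · simp [hK, hp]
  rw [shiftTwo, Finsupp.sum_apply]
  simp only [key, Finsupp.sum]
  rw [Finset.sum_ite_eq']
  by_cases hm : (J, I.parent) ∈ c.support
  · simp [shiftTwoSeries, hm]
  · have h0 : c (J, I.parent) = 0 := by simpa using hm
    simp [shiftTwoSeries, h0]

theorem DyadicInterval.memLp_haar (I : DyadicInterval) : MemLp I.haar 2 volume := by
  have h : ∀ K : DyadicInterval,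
      MemLp (K.toSet.indicator (fun _ => (1 : ℝ))) 2 volume := fun K =>
    memLp_indicator_const 2 measurableSet_Ico 1 (Or.inr (by simp [Real.volume_Ico]))
  exact ((h I.plus).sub (h I.minus)).const_mul _

theorem memLp_haarRect (R : DyadicRect) : MemLp (haarRect R) 2 volume := by
  have hm : AEStronglyMeasurable (haarRect R) (volume : Measure (ℝ × ℝ)) :=
    (R.1.memLp_haar.1.comp_fst (ν := volume)).mul (R.2.memLp_haar.1.comp_snd (μ := volume))
  rw [memLp_two_iff_integrable_sq hm]
  have h := (R.1.memLp_haar.integrable_sq).mul_prod (R.2.memLp_haar.integrable_sq)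
  refine h.congr (Filter.Eventually.of_forall fun p => ?_)
  simp [haarRect, mul_pow]

theorem memLp_haarSum (c : DyadicRect →₀ 𝕜) : MemLp (haarSum c) 2 volume := by
  have h : MemLp (fun p => ∑ R ∈ c.support, c R * ((haarRect R p : ℝ) : 𝕜)) 2 volume :=
    memLp_finsetSum _ fun R _ => ((memLp_haarRect R).ofReal).const_mul _
  exact h

/-- The bounded operator `S` on `L²(ℝ²)` is the repeated commutator `[T₂, [T₁, b]]`: on every
finite Haar sum `f` the Haar coefficients of `S f` are those of `[T₂, [T₁, b]] f`. (Finite Haar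
sums are dense in `L²(ℝ²)` and the Haar functions form an orthonormal basis, so there is at most
one such `S`.) -/
def IsRepeatedCommutator (b : ℝ × ℝ → 𝕜)
    (S : Lp 𝕜 2 (volume : Measure (ℝ × ℝ)) →L[𝕜] Lp 𝕜 2 (volume : Measure (ℝ × ℝ))) : Prop :=
  ∀ (c : DyadicRect →₀ 𝕜) (R : DyadicRect),
    haarCoeff (S ((memLp_haarSum c).toLp (haarSum c))) R = repeatedCommutator b c R

/-- `[T₂, [T₁, b]]`, initially given on finite Haar sums, is bounded on `L²(ℝ²)`. -/
def IsBoundedRepeatedCommutator (b : ℝ × ℝ → 𝕜) : Prop :=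
  ∃ S : Lp 𝕜 2 (volume : Measure (ℝ × ℝ)) →L[𝕜] Lp 𝕜 2 (volume : Measure (ℝ × ℝ)),
    IsRepeatedCommutator b S

/-- The sum of `|(b, h_I ⊗ h_J)|²` over all dyadic `I ⊆ I₀` and `J ⊆ J₀`. -/
def rectSquareSum (b : ℝ × ℝ → 𝕜) (I₀ J₀ : DyadicInterval) : ℝ≥0∞ :=
  ∑' R : {R : DyadicRect // R.1.toSet ⊆ I₀.toSet ∧ R.2.toSet ⊆ J₀.toSet},
    ‖haarCoeff b R.1‖ₑ ^ 2

/-- Dyadic rectangular BMO: the sums above are at most `C |I₀| |J₀|`, with one finite `C`. -/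
def MemRectBMO (b : ℝ × ℝ → 𝕜) : Prop :=
  ∃ C : ℝ≥0, ∀ I₀ J₀ : DyadicInterval,
    rectSquareSum b I₀ J₀ ≤ C * ENNReal.ofReal (I₀.length * J₀.length)

end Commutator

end

open MeasureTheory
open scoped ENNReal NNReal

noncomputable section

/-! ### Dyadic intervals: parents, nesting, parity. -/

namespace DyadicInterval

/-! Test the commutator on a single function `h_I ⊗ h_J`. Enlarge `I₀`, `J₀` to even `M`, `N` at the
cost of a factor 2 in length, and let `I`, `J` be their grandparents, again even. On `M` both `h_I`
and `T₁ h_I` are constants `α`, `α'`, and likewise `β`, `β'` on `N`, so inside `M × N` every product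
with `b` in the commutator has a constant multiple of the Haar coefficients of `b`.

In one variable the commutator coefficient at `K ⊆ M` is therefore `-α' a_K` for even `K` and `± α
a_P - α' a_K` for odd `K` with parent `P`. This system is triangular and `α'² = 2α²`, so it inverts
with a uniform constant (`norm_sq_le_of_shiftCommutator`, `tsum_descendants_le`). In two variables
the coefficients are the iterate of the two one-variable expressions (`repeatedCommutator_single`),
and the inversion is done one variable at a time (`tsum_descendants_prod_le`). Bessel's inequality
bounds the square sum of the commutator coefficients by `‖S‖²`, and dividing by `α'² β'²`, which is
comparable to `1 / (|I₀| |J₀|)`, gives the bound. -/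

theorem length_pos (I : DyadicInterval) : 0 < I.length := by
  unfold length; positivity

theorem length_parent (I : DyadicInterval) : I.parent.length = 2 * I.length := by
  simp only [length, parent]
  rw [show -(I.scale - 1) = -I.scale + 1 by ring, zpow_add₀ two_ne_zero]
  ring

theorem length_plus (I : DyadicInterval) : I.plus.length = I.length / 2 := by
  simp only [length, plus]
  rw [show -(I.scale + 1) = -I.scale - 1 by ring, zpow_sub₀ two_ne_zero]
  ring

theorem length_minus (I : DyadicInterval) : I.minus.length = I.length / 2 :=
  I.length_plus

theorem mem_toSet_iff (I : DyadicInterval) (x : ℝ) :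
    x ∈ I.toSet ↔ ⌊x / I.length⌋ = I.index := by
  rw [toSet, Set.mem_Ico, Int.floor_eq_iff, le_div_iff₀ I.length_pos, div_lt_iff₀ I.length_pos]

theorem eq_of_mem_toSet {I J : DyadicInterval} {x : ℝ} (hI : x ∈ I.toSet) (hJ : x ∈ J.toSet)
    (h : I.scale = J.scale) : I = J := by
  rw [mem_toSet_iff] at hI hJ
  have hl : I.length = J.length := by simp [length, h]
  rw [hl] at hI
  exact DyadicInterval.ext h (hI.symm.trans hJ)

theorem plus_or_minus_parent (I : DyadicInterval) : I = I.parent.plus ∨ I = I.parent.minus := by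
  rcases I.sign_eq with h | h
  · exact Or.inl ((I.eq_plus_iff _).2 ⟨rfl, h⟩)
  · exact Or.inr ((I.eq_minus_iff _).2 ⟨rfl, h⟩)

theorem toSet_plus_subset (I : DyadicInterval) : I.plus.toSet ⊆ I.toSet := by
  have h := I.length_pos
  rw [toSet, toSet, length_plus]
  apply Set.Ico_subset_Ico <;> simp only [plus] <;> push_cast <;> nlinarith

theorem toSet_minus_subset (I : DyadicInterval) : I.minus.toSet ⊆ I.toSet := by
  have h := I.length_pos
  rw [toSet, toSet, length_minus]
  apply Set.Ico_subset_Ico <;> simp only [minus] <;> push_cast <;> nlinarith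

theorem toSet_subset_parent (I : DyadicInterval) : I.toSet ⊆ I.parent.toSet := by
  rcases I.plus_or_minus_parent with h | h
  · conv_lhs => rw [h]
    exact I.parent.toSet_plus_subset
  · conv_lhs => rw [h]
    exact I.parent.toSet_minus_subset

theorem toSet_subset_iterate_parent (I : DyadicInterval) (n : ℕ) :
    I.toSet ⊆ (parent^[n] I).toSet := by
  induction n with
  | zero => exact subset_rfl
  | succ n ih =>
    rw [Function.iterate_succ_apply']
    exact ih.trans (toSet_subset_parent _)

theorem scale_iterate_parent (I : DyadicInterval) (n : ℕ) :
    (parent^[n] I).scale = I.scale - n := by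
  induction n with
  | zero => simp
  | succ n ih =>
    rw [Function.iterate_succ_apply']
    simp only [parent, ih]
    push_cast
    ring

theorem toSet_nonempty (I : DyadicInterval) : I.toSet.Nonempty := by
  refine ⟨I.index * I.length, le_rfl, ?_⟩
  have h := I.length_pos
  nlinarith

/-- Two dyadic intervals with a common point are nested. -/
theorem iterate_parent_eq_of_mem {I J : DyadicInterval} {x : ℝ} (hI : x ∈ I.toSet)
    (hJ : x ∈ J.toSet) (h : J.scale ≤ I.scale) :
    parent^[(I.scale - J.scale).toNat] I = J := by
  refine eq_of_mem_toSet (toSet_subset_iterate_parent I _ hI) hJ ?_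
  rw [scale_iterate_parent]
  omega

theorem measurableSet_toSet (I : DyadicInterval) : MeasurableSet I.toSet :=
  measurableSet_Ico

theorem volume_toSet (I : DyadicInterval) : volume I.toSet = ENNReal.ofReal I.length := by
  rw [toSet, Real.volume_Ico]
  congr 1
  ring

theorem scale_le_of_subset {I J : DyadicInterval} (h : I.toSet ⊆ J.toSet) :
    J.scale ≤ I.scale := by
  have h1 : volume I.toSet ≤ volume J.toSet := measure_mono h
  rw [volume_toSet, volume_toSet, ENNReal.ofReal_le_ofReal_iff J.length_pos.le, length, length,
    zpow_le_zpow_iff_right₀ one_lt_two] at h1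
  omega

/-- The dyadic descendants of `M`, including `M` itself. -/
def descendants (M : DyadicInterval) : Set DyadicInterval := {K | ∃ n, parent^[n] K = M}

theorem mem_descendants_of_subset {I J : DyadicInterval} (h : I.toSet ⊆ J.toSet) :
    I ∈ J.descendants := by
  obtain ⟨x, hx⟩ := I.toSet_nonempty
  exact ⟨_, iterate_parent_eq_of_mem hx (h hx) (scale_le_of_subset h)⟩

theorem toSet_subset_of_mem_descendants {K M : DyadicInterval} (h : K ∈ M.descendants) :
    K.toSet ⊆ M.toSet := by
  obtain ⟨n, rfl⟩ := h
  exact toSet_subset_iterate_parent K n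

theorem isEven_parent_iff (I : DyadicInterval) : I.parent.IsEven ↔ ¬ I.IsEven := by
  simp only [IsEven, parent]
  grind

/-- This is why `M` is taken even: an odd `K` below `M` differs from `M`, so the parent from which
the shift feeds `K` is still below `M`. -/
theorem parent_mem_descendants {K M : DyadicInterval} (h : K ∈ M.descendants) (hM : M.IsEven)
    (hK : K.parent.IsEven) : K.parent ∈ M.descendants := by
  obtain ⟨n, hn⟩ := h
  cases n with
  | zero =>
    subst hn
    exact absurd hM ((isEven_parent_iff _).1 hK)
  | succ n => exact ⟨n, hn⟩

theorem exists_even_ancestor (I : DyadicInterval) :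
    ∃ M : DyadicInterval, M.IsEven ∧ I.toSet ⊆ M.toSet ∧ M.length ≤ 2 * I.length := by
  by_cases h : I.IsEven
  · exact ⟨I, h, subset_rfl, by linarith [I.length_pos]⟩
  · exact ⟨I.parent, (isEven_parent_iff I).2 h, I.toSet_subset_parent, I.length_parent.le⟩

/-! ### Haar functions: values, local constancy and orthonormality. -/

theorem disjoint_plus_minus (I : DyadicInterval) : Disjoint I.plus.toSet I.minus.toSet := by
  rw [Set.disjoint_left]
  intro x h1 h2
  have h := eq_of_mem_toSet h1 h2 rfl
  simp only [plus, minus, DyadicInterval.mk.injEq] at h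
  omega

theorem haar_of_mem_plus {I : DyadicInterval} {x : ℝ} (h : x ∈ I.plus.toSet) :
    I.haar x = (Real.sqrt I.length)⁻¹ := by
  simp [haar, h, Set.disjoint_left.1 I.disjoint_plus_minus h]

theorem haar_of_mem_minus {I : DyadicInterval} {x : ℝ} (h : x ∈ I.minus.toSet) :
    I.haar x = -(Real.sqrt I.length)⁻¹ := by
  simp [haar, h, Set.disjoint_right.1 I.disjoint_plus_minus h]

theorem haar_of_notMem {I : DyadicInterval} {x : ℝ} (h : x ∉ I.toSet) : I.haar x = 0 := by
  have h1 : x ∉ I.plus.toSet := fun h' => h (I.toSet_plus_subset h')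
  have h2 : x ∉ I.minus.toSet := fun h' => h (I.toSet_minus_subset h')
  simp [haar, h1, h2]

/-- The Haar function of the parent is constant on a dyadic interval. -/
theorem exists_haar_parent_eq (I : DyadicInterval) :
    ∃ α : ℝ, α ^ 2 = I.parent.length⁻¹ ∧ ∀ x ∈ I.toSet, I.parent.haar x = α := by
  have hs : ((Real.sqrt I.parent.length)⁻¹) ^ 2 = I.parent.length⁻¹ := by
    rw [inv_pow, Real.sq_sqrt I.parent.length_pos.le]
  rcases I.plus_or_minus_parent with h | h
  · exact ⟨_, hs, fun x hx => haar_of_mem_plus (h ▸ hx)⟩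
  · exact ⟨_, (neg_sq _).trans hs, fun x hx => haar_of_mem_minus (h ▸ hx)⟩

/-- `T h_I = h_{I₊} - h_{I₋}` is constant on the grandchildren of `I`. -/
theorem exists_shift_haar_eq (M : DyadicInterval) :
    ∃ α : ℝ, α ^ 2 = M.parent.length⁻¹ ∧ ∀ x ∈ M.toSet,
      M.parent.parent.plus.haar x - M.parent.parent.minus.haar x = α := by
  obtain ⟨α, hα, hc⟩ := M.exists_haar_parent_eq
  have hd := M.parent.parent.disjoint_plus_minus
  rcases M.parent.plus_or_minus_parent with h | h
  · refine ⟨α, hα, fun x hx => ?_⟩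
    have hx' : x ∈ M.parent.parent.plus.toSet := h ▸ M.toSet_subset_parent hx
    -- `M` lies in one half of its grandparent, so the Haar function of the other half vanishes on
    -- it.
    rw [haar_of_notMem (Set.disjoint_left.1 hd hx'), ← h, hc x hx, sub_zero]
  · refine ⟨-α, (neg_sq α).trans hα, fun x hx => ?_⟩
    have hx' : x ∈ M.parent.parent.minus.toSet := h ▸ M.toSet_subset_parent hx
    rw [haar_of_notMem (Set.disjoint_right.1 hd hx'), ← h, hc x hx, zero_sub]

theorem exists_haar_grandparent_eq (M : DyadicInterval) :
    ∃ α : ℝ, α ^ 2 = M.parent.parent.length⁻¹ ∧ ∀ x ∈ M.toSet, M.parent.parent.haar x = α := by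
  obtain ⟨α, hα, hc⟩ := M.parent.exists_haar_parent_eq
  exact ⟨α, hα, fun x hx => hc x (M.toSet_subset_parent hx)⟩

theorem integral_haar (I : DyadicInterval) : ∫ x, I.haar x = 0 := by
  have hi : ∀ K : DyadicInterval, Integrable (K.toSet.indicator fun _ => (1 : ℝ)) := fun K =>
    (integrable_indicator_iff K.measurableSet_toSet).2
      (integrableOn_const (K.volume_toSet.trans_ne ENNReal.ofReal_ne_top))
  have hv : ∀ K : DyadicInterval, ∫ x, K.toSet.indicator (fun _ => (1 : ℝ)) x = K.length := by
    intro K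
    rw [integral_indicator K.measurableSet_toSet, setIntegral_const, Measure.real, volume_toSet,
      ENNReal.toReal_ofReal K.length_pos.le]
    simp
  simp only [haar]
  rw [integral_const_mul, integral_sub (hi _) (hi _), hv, hv, length_plus, length_minus]
  simp

theorem integral_haar_mul_self (I : DyadicInterval) : ∫ x, I.haar x * I.haar x = 1 := by
  have h : ∀ x, I.haar x * I.haar x = I.toSet.indicator (fun _ => I.length⁻¹) x := by
    intro x
    have hs : (Real.sqrt I.length)⁻¹ * (Real.sqrt I.length)⁻¹ = I.length⁻¹ := by
      rw [← mul_inv, Real.mul_self_sqrt I.length_pos.le]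
    by_cases hx : x ∈ I.toSet
    · rw [Set.indicator_of_mem hx]
      have : x ∈ I.plus.toSet ∨ x ∈ I.minus.toSet := by
        have h := I.length_pos
        simp only [toSet, length_plus, length_minus, Set.mem_Ico] at hx ⊢
        simp only [plus, minus]
        push_cast
        rcases le_or_gt ((2 * (I.index : ℝ) + 1) * (I.length / 2)) x with h1 | h1
        · exact Or.inl ⟨h1, by nlinarith⟩
        · exact Or.inr ⟨by nlinarith, h1⟩
      rcases this with h1 | h1
      · rw [haar_of_mem_plus h1, hs]
      · rw [haar_of_mem_minus h1, neg_mul_neg, hs]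
    · rw [Set.indicator_of_notMem hx, haar_of_notMem hx, zero_mul]
  simp only [h]
  rw [integral_indicator I.measurableSet_toSet, setIntegral_const, Measure.real, volume_toSet,
    ENNReal.toReal_ofReal I.length_pos.le, smul_eq_mul, mul_inv_cancel₀ I.length_pos.ne']

/-- If the intervals meet, the Haar function of the longer one is constant on the shorter one, whose
own Haar function has mean zero. -/
theorem integral_haar_mul_haar_of_scale_lt {I J : DyadicInterval} (h : J.scale < I.scale) :
    ∫ x, I.haar x * J.haar x = 0 := by
  by_cases hd : ∃ x, x ∈ I.toSet ∧ x ∈ J.toSet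
  · obtain ⟨x, hI, hJ⟩ := hd
    have hp := iterate_parent_eq_of_mem hI hJ h.le
    obtain ⟨n, hn⟩ : ∃ n, (I.scale - J.scale).toNat = n + 1 :=
      ⟨(I.scale - J.scale).toNat - 1, by omega⟩
    rw [hn, Function.iterate_succ_apply'] at hp
    obtain ⟨α, -, hα⟩ := (parent^[n] I).exists_haar_parent_eq
    rw [hp] at hα
    have : ∀ y, I.haar y * J.haar y = I.haar y * α := by
      intro y
      by_cases hy : y ∈ I.toSet
      · rw [hα y (toSet_subset_iterate_parent I n hy)]
      · rw [haar_of_notMem hy, zero_mul, zero_mul]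
    simp only [this]
    rw [integral_mul_const, integral_haar, zero_mul]
  · push Not at hd
    have : ∀ y, I.haar y * J.haar y = 0 := by
      intro y
      by_cases hy : y ∈ I.toSet
      · rw [haar_of_notMem (hd y hy), mul_zero]
      · rw [haar_of_notMem hy, zero_mul]
    simp [this]

theorem integral_haar_mul_haar (I J : DyadicInterval) :
    ∫ x, I.haar x * J.haar x = if I = J then 1 else 0 := by
  split_ifs with h
  · rw [← h, integral_haar_mul_self]
  · rcases lt_trichotomy I.scale J.scale with hs | hs | hs
    · simp only [mul_comm (I.haar _)]
      exact integral_haar_mul_haar_of_scale_lt hs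
    · have : ∀ y, I.haar y * J.haar y = 0 := by
        intro y
        by_cases hI : y ∈ I.toSet
        · by_cases hJ : y ∈ J.toSet
          · exact absurd (eq_of_mem_toSet hI hJ hs) h
          · rw [haar_of_notMem hJ, mul_zero]
        · rw [haar_of_notMem hI, zero_mul]
      simp [this]
    · exact integral_haar_mul_haar_of_scale_lt hs

/-! ### Sums over parents. -/

/-- Every dyadic interval is the parent of exactly two dyadic intervals. -/
theorem tsum_comp_parent_le (G : DyadicInterval → ℝ≥0∞) :
    ∑' K : DyadicInterval, G K.parent ≤ 2 * ∑' K, G K := by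
  -- An interval is determined by its parent and by which half of it it is.
  have hinj : Function.Injective
      (fun K : DyadicInterval => (decide (K.sign = 1), K.parent)) := by
    intro K L h
    simp only [Prod.mk.injEq, decide_eq_decide] at h
    by_cases hK : K.sign = 1
    · rw [(K.eq_plus_iff K.parent).2 ⟨rfl, hK⟩, (L.eq_plus_iff L.parent).2 ⟨rfl, h.1.1 hK⟩, h.2]
    · have hL : L.sign ≠ 1 := fun h' => hK (h.1.2 h')
      rw [(K.eq_minus_iff K.parent).2 ⟨rfl, K.sign_eq.resolve_left hK⟩,
        (L.eq_minus_iff L.parent).2 ⟨rfl, L.sign_eq.resolve_left hL⟩, h.2]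
  calc ∑' K : DyadicInterval, G K.parent
      ≤ ∑' p : Bool × DyadicInterval, G p.2 :=
        ENNReal.tsum_comp_le_tsum_of_injective hinj fun p => G p.2
    _ = 2 * ∑' K, G K := by
        rw [ENNReal.tsum_prod', tsum_bool, two_mul]

theorem tsum_le_of_le_add_parent {A G : DyadicInterval → ℝ≥0∞}
    (h : ∀ K, A K ≤ 2 * G K + G K.parent) : ∑' K, A K ≤ 4 * ∑' K, G K :=
  calc ∑' K, A K ≤ ∑' K, (2 * G K + G K.parent) := ENNReal.tsum_le_tsum h
    _ = 2 * ∑' K, G K + ∑' K : DyadicInterval, G K.parent := by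
        rw [ENNReal.tsum_add, ENNReal.tsum_mul_left]
    _ ≤ 2 * ∑' K, G K + 2 * ∑' K, G K := by gcongr; exact tsum_comp_parent_le G
    _ = 4 * ∑' K, G K := by rw [← add_mul]; norm_num

end DyadicInterval

/-! ### The bi-parameter Haar system in `L²` and Bessel's inequality. -/

theorem integral_haarRect_mul_haarRect (R Q : DyadicRect) :
    ∫ p, haarRect R p * haarRect Q p = if R = Q then 1 else 0 := by
  have h : ∀ p : ℝ × ℝ, haarRect R p * haarRect Q p =
      (R.1.haar p.1 * Q.1.haar p.1) * (R.2.haar p.2 * Q.2.haar p.2) := fun p => by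
    simp only [haarRect]; ring
  simp only [h]
  rw [Measure.volume_eq_prod, integral_prod_mul (fun x => R.1.haar x * Q.1.haar x)
    (fun y => R.2.haar y * Q.2.haar y), DyadicInterval.integral_haar_mul_haar,
    DyadicInterval.integral_haar_mul_haar]
  simp only [Prod.ext_iff]
  split_ifs <;> simp_all

section Commutator

variable {𝕜 : Type*} [RCLike 𝕜]

variable (𝕜) in
/-- The Haar function of a dyadic rectangle as an element of `L²(ℝ²)`. -/
def haarLp (R : DyadicRect) : Lp 𝕜 2 (volume : Measure (ℝ × ℝ)) :=
  (memLp_haarRect R).ofReal.toLp fun p => ((haarRect R p : ℝ) : 𝕜)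

theorem coeFn_haarLp (R : DyadicRect) :
    haarLp 𝕜 R =ᵐ[volume] fun p => ((haarRect R p : ℝ) : 𝕜) :=
  MemLp.coeFn_toLp _

theorem inner_haarLp (R : DyadicRect) (u : Lp 𝕜 2 (volume : Measure (ℝ × ℝ))) :
    inner 𝕜 (haarLp 𝕜 R) u = haarCoeff u R := by
  rw [L2.inner_def, haarCoeff]
  refine integral_congr_ae ?_
  filter_upwards [coeFn_haarLp (𝕜 := 𝕜) R] with p hp
  rw [hp]
  simp [RCLike.inner_apply]

theorem orthonormal_haarLp : Orthonormal 𝕜 (haarLp 𝕜) := by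
  classical
  rw [orthonormal_iff_ite]
  intro R Q
  have h : ∫ p, ((haarRect R p : ℝ) : 𝕜) * ((haarRect Q p : ℝ) : 𝕜) = if R = Q then 1 else 0 := by
    have := congrArg (fun r : ℝ => (r : 𝕜)) (integral_haarRect_mul_haarRect R Q)
    simp only [← integral_ofReal, RCLike.ofReal_mul] at this
    rw [this]
    split_ifs <;> simp
  rw [inner_haarLp, haarCoeff, ← h]
  refine integral_congr_ae ?_
  filter_upwards [coeFn_haarLp (𝕜 := 𝕜) Q] with p hp
  rw [hp, mul_comm]

/-- Bessel's inequality for the bi-parameter Haar system. -/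
theorem tsum_haarCoeff_le (u : Lp 𝕜 2 (volume : Measure (ℝ × ℝ))) :
    ∑' R, ‖haarCoeff u R‖ₑ ^ 2 ≤ ‖u‖ₑ ^ 2 := by
  have h1 := (orthonormal_haarLp (𝕜 := 𝕜)).tsum_inner_products_le u
  have h2 := (orthonormal_haarLp (𝕜 := 𝕜)).inner_products_summable u
  simp only [inner_haarLp] at h1 h2
  have h3 := ENNReal.ofReal_le_ofReal h1
  rw [ENNReal.ofReal_tsum_of_nonneg (fun _ => by positivity) h2] at h3
  simpa only [ENNReal.ofReal_pow (norm_nonneg _), ofReal_norm] using h3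

/-! ### The commutator on one tensor Haar function. -/

theorem haarSum_single (R : DyadicRect) (a : 𝕜) (p : ℝ × ℝ) :
    haarSum (Finsupp.single R a) p = a * ((haarRect R p : ℝ) : 𝕜) := by
  simp [haarSum]

theorem haarSum_sub (c d : DyadicRect →₀ 𝕜) (p : ℝ × ℝ) :
    haarSum (c - d) p = haarSum c p - haarSum d p :=
  Finsupp.sum_sub_index fun _ _ _ => sub_mul _ _ _

theorem shiftOne_single {R : DyadicRect} (h : R.1.IsEven) (a : 𝕜) :
    shiftOne (Finsupp.single R a) =
      Finsupp.single (R.1.plus, R.2) a - Finsupp.single (R.1.minus, R.2) a := by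
  simp [shiftOne, h]

theorem shiftTwo_single {R : DyadicRect} (h : R.2.IsEven) (a : 𝕜) :
    shiftTwo (Finsupp.single R a) =
      Finsupp.single (R.1, R.2.plus) a - Finsupp.single (R.1, R.2.minus) a := by
  simp [shiftTwo, h]

theorem shiftOne_sub (c d : DyadicRect →₀ 𝕜) : shiftOne (c - d) = shiftOne c - shiftOne d := by
  refine Finsupp.sum_sub_index fun R a b => ?_
  split_ifs
  · simp only [Finsupp.single_sub]; abel
  · simp

theorem norm_toLp_haarSum_single (R : DyadicRect) :
    ‖(memLp_haarSum (Finsupp.single R (1 : 𝕜))).toLp (haarSum (Finsupp.single R (1 : 𝕜)))‖ = 1 := by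
  rw [← (orthonormal_haarLp (𝕜 := 𝕜)).1 R, haarLp]
  congr 2
  funext p
  rw [haarSum_single, one_mul]

/-- If `f` is constant on a rectangle, then the Haar coefficients of `b f` inside the rectangle
are that constant times those of `b`. -/
theorem mulSymbol_eq_of_const {b : ℝ × ℝ → 𝕜} {c : DyadicRect →₀ 𝕜} {M N : Set ℝ} {γ : 𝕜}
    (hc : ∀ x ∈ M, ∀ y ∈ N, haarSum c (x, y) = γ) {R : DyadicRect}
    (h1 : R.1.toSet ⊆ M) (h2 : R.2.toSet ⊆ N) :
    mulSymbol b c R = γ * haarCoeff b R := by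
  rw [mulSymbol, haarCoeff, haarCoeff, ← integral_const_mul]
  congr 1
  funext ⟨x, y⟩
  by_cases hx : x ∈ R.1.toSet
  · by_cases hy : y ∈ R.2.toSet
    · rw [hc x (h1 hx) y (h2 hy)]
      ring
    · simp [haarRect, DyadicInterval.haar_of_notMem hy]
  · simp [haarRect, DyadicInterval.haar_of_notMem hx]

/-- The one-parameter commutator with the shift, tested on a Haar function `h_I` for which
`h_I = α` and `T h_I = β` on the intervals under consideration, acts on Haar coefficients in
this way. -/
def shiftCommutator (α β : ℝ) (a : DyadicInterval → 𝕜) (K : DyadicInterval) : 𝕜 :=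
  (if K.parent.IsEven then (K.sign : 𝕜) * ((α : 𝕜) * a K.parent) else 0) - (β : 𝕜) * a K

/-- Expanding the composition of the two one-variable commutators gives exactly the four terms of
the definition, because the constants attached to the test function factor as a product over the two
variables. -/
theorem repeatedCommutator_single {b : ℝ × ℝ → 𝕜} {M N I J : DyadicInterval} {α α' β β' : ℝ}
    (hM : M.IsEven) (hN : N.IsEven) (hI : I.IsEven) (hJ : J.IsEven)
    (hα : ∀ x ∈ M.toSet, I.haar x = α)
    (hα' : ∀ x ∈ M.toSet, I.plus.haar x - I.minus.haar x = α')
    (hβ : ∀ x ∈ N.toSet, J.haar x = β)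
    (hβ' : ∀ x ∈ N.toSet, J.plus.haar x - J.minus.haar x = β')
    {K L : DyadicInterval} (hK : K ∈ M.descendants) (hL : L ∈ N.descendants) :
    repeatedCommutator b (Finsupp.single (I, J) 1) (K, L) =
      shiftCommutator β β' (fun L => shiftCommutator α α' (fun K => haarCoeff b (K, L)) K) L := by
  have key : ∀ (c : DyadicRect →₀ 𝕜) (γ : 𝕜)
      (_ : ∀ x ∈ M.toSet, ∀ y ∈ N.toSet, haarSum c (x, y) = γ)
      (K' L' : DyadicInterval), K' ∈ M.descendants → L' ∈ N.descendants →
      mulSymbol b c (K', L') = γ * haarCoeff b (K', L') := fun c γ hc K' L' h1 h2 =>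
    mulSymbol_eq_of_const hc (DyadicInterval.toSet_subset_of_mem_descendants h1)
      (DyadicInterval.toSet_subset_of_mem_descendants h2)
  have k0 := key (Finsupp.single (I, J) 1) ((α : 𝕜) * β) (fun x hx y hy => by
    simp [haarSum_single, haarRect, hα x hx, hβ y hy])
  have k1 := key (shiftOne (Finsupp.single (I, J) 1)) ((α' : 𝕜) * β) (fun x hx y hy => by
    rw [shiftOne_single hI, haarSum_sub]
    simp [haarSum_single, haarRect, ← hα' x hx, hβ y hy, sub_mul])
  have k2 := key (shiftTwo (Finsupp.single (I, J) 1)) ((α : 𝕜) * β') (fun x hx y hy => by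
    rw [shiftTwo_single hJ, haarSum_sub]
    simp [haarSum_single, haarRect, hα x hx, ← hβ' y hy, mul_sub])
  have k3 := key (shiftOne (shiftTwo (Finsupp.single (I, J) 1))) ((α' : 𝕜) * β')
    (fun x hx y hy => by
      rw [shiftTwo_single hJ, shiftOne_sub, shiftOne_single hI, shiftOne_single hI]
      simp only [haarSum_sub]
      simp [haarSum_single, haarRect, ← hα' x hx, ← hβ' y hy]
      ring)
  simp only [repeatedCommutator, shiftTwoSeries, shiftOneSeries, shiftCommutator]
  rw [k3 K L hK hL]
  by_cases h1 : K.parent.IsEven <;> by_cases h2 : L.parent.IsEven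
  · have hK' := DyadicInterval.parent_mem_descendants hK hM h1
    have hL' := DyadicInterval.parent_mem_descendants hL hN h2
    simp only [h1, h2, if_true, k0 _ _ hK' hL', k1 _ _ hK hL', k2 _ _ hK' hL]
    ring
  · have hK' := DyadicInterval.parent_mem_descendants hK hM h1
    simp only [h1, h2, if_true, if_false, k2 _ _ hK' hL]
    ring
  · have hL' := DyadicInterval.parent_mem_descendants hL hN h2
    simp only [h1, h2, if_true, if_false, k1 _ _ hK hL']
    ring
  · simp only [h1, h2, if_false]
    ring

/-! ### Recovering the coefficients of `b` from those of the commutator. -/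

/-- Triangular inversion: at even intervals the commutator only multiplies by `-β`, so at an odd `K`
the unwanted parent term is already controlled by the commutator coefficient at the parent. -/
theorem norm_sq_le_of_shiftCommutator {α β : ℝ} (h : β ^ 2 = 2 * α ^ 2) (a : DyadicInterval → 𝕜)
    (K : DyadicInterval) :
    ‖a K‖ ^ 2 * β ^ 2 ≤ 2 * ‖shiftCommutator α β a K‖ ^ 2 +
      if K.parent.IsEven then ‖shiftCommutator α β a K.parent‖ ^ 2 else 0 := by
  split_ifs with hK
  · have hp : shiftCommutator α β a K.parent = -((β : 𝕜) * a K.parent) := by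
      have : ¬ K.parent.parent.IsEven := by
        rw [DyadicInterval.isEven_parent_iff]; exact not_not.2 hK
      simp [shiftCommutator, this]
    have hn : ‖(β : 𝕜) * a K‖ ≤ ‖shiftCommutator α β a K‖ + |α| * ‖a K.parent‖ := by
      have he : (β : 𝕜) * a K =
          (K.sign : 𝕜) * ((α : 𝕜) * a K.parent) - shiftCommutator α β a K := by
        simp [shiftCommutator, hK]
      have hs : ‖(K.sign : 𝕜)‖ = 1 := by rcases K.sign_eq with h | h <;> simp [h]
      rw [he]
      refine (norm_sub_le _ _).trans_eq ?_
      rw [norm_mul, hs, norm_mul, RCLike.norm_ofReal, one_mul, add_comm]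
    rw [hp, norm_neg]
    rw [norm_mul, RCLike.norm_ofReal] at hn ⊢
    have h0 : 0 ≤ |β| * ‖a K‖ := by positivity
    have h1 := pow_le_pow_left₀ h0 hn 2
    rw [mul_pow, sq_abs] at h1 ⊢
    have h2 : (|α| * ‖a K.parent‖) ^ 2 = α ^ 2 * ‖a K.parent‖ ^ 2 := by rw [mul_pow, sq_abs]
    rw [h]
    rw [h] at h1
    -- `(x + y)² ≤ 2x² + 2y²` with `y = |α| ‖a K.parent‖`; since `2α² = β²`, the term `2y²` is the
    -- squared coefficient at the parent.
    nlinarith [sq_nonneg (‖shiftCommutator α β a K‖ - |α| * ‖a K.parent‖)]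
  · have hp : shiftCommutator α β a K = -((β : 𝕜) * a K) := by simp [shiftCommutator, hK]
    rw [hp, norm_neg, norm_mul, RCLike.norm_ofReal, mul_pow, sq_abs]
    nlinarith [mul_nonneg (sq_nonneg β) (sq_nonneg ‖a K‖)]

/-- The Haar coefficients below `M` are controlled by those of the commutator. -/
theorem tsum_descendants_le {M : DyadicInterval} (hM : M.IsEven) {α β : ℝ}
    (h : β ^ 2 = 2 * α ^ 2) (a : DyadicInterval → 𝕜) :
    (∑' K : M.descendants, ‖a K‖ₑ ^ 2) * ENNReal.ofReal (β ^ 2) ≤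
      4 * ∑' K : M.descendants, ‖shiftCommutator α β a K‖ₑ ^ 2 := by
  rw [← ENNReal.tsum_mul_right,
    tsum_subtype M.descendants (fun K => ‖a K‖ₑ ^ 2 * ENNReal.ofReal (β ^ 2)),
    tsum_subtype M.descendants (fun K => ‖shiftCommutator α β a K‖ₑ ^ 2)]
  refine DyadicInterval.tsum_le_of_le_add_parent fun K => ?_
  by_cases hK : K ∈ M.descendants
  · have h1 := ENNReal.ofReal_le_ofReal (norm_sq_le_of_shiftCommutator h a K)
    rw [ENNReal.ofReal_mul (by positivity), ENNReal.ofReal_add (by positivity)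
      (by split_ifs <;> positivity), ENNReal.ofReal_mul (by norm_num)] at h1
    simp only [ENNReal.ofReal_pow (norm_nonneg _), ofReal_norm] at h1
    rw [Set.indicator_of_mem hK, Set.indicator_of_mem hK]
    refine h1.trans ?_
    rw [ENNReal.ofReal_ofNat]
    gcongr
    split_ifs with hp
    · rw [Set.indicator_of_mem (DyadicInterval.parent_mem_descendants hK hM hp),
        ENNReal.ofReal_pow (norm_nonneg _), ofReal_norm]
    · simp
  · rw [Set.indicator_of_notMem hK]
    exact zero_le

/-- The inversion in `K` for each fixed `L`, then in `L` for each fixed `K`, each costing a factor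
4. -/
theorem tsum_descendants_prod_le {M N : DyadicInterval} (hM : M.IsEven) (hN : N.IsEven)
    {α α' β β' : ℝ} (hα : α' ^ 2 = 2 * α ^ 2) (hβ : β' ^ 2 = 2 * β ^ 2)
    (a : DyadicInterval → DyadicInterval → 𝕜) :
    (∑' K : M.descendants, ∑' L : N.descendants, ‖a K L‖ₑ ^ 2) *
        ENNReal.ofReal (α' ^ 2 * β' ^ 2) ≤
      16 * ∑' K : M.descendants, ∑' L : N.descendants,
        ‖shiftCommutator β β' (fun L => shiftCommutator α α' (fun K => a K L) K) L‖ₑ ^ 2 := by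
  rw [ENNReal.ofReal_mul (sq_nonneg _), ← mul_assoc, ENNReal.tsum_comm, ← ENNReal.tsum_mul_right,
    show (16 : ℝ≥0∞) = 4 * 4 by norm_num, mul_assoc, ← ENNReal.tsum_mul_left]
  calc (∑' L : N.descendants, (∑' K : M.descendants, ‖a K L‖ₑ ^ 2) * ENNReal.ofReal (α' ^ 2)) *
        ENNReal.ofReal (β' ^ 2)
      ≤ (∑' L : N.descendants, 4 * ∑' K : M.descendants,
          ‖shiftCommutator α α' (fun K => a K L) K‖ₑ ^ 2) * ENNReal.ofReal (β' ^ 2) := by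
        refine mul_le_mul_left (ENNReal.tsum_le_tsum fun L => ?_) _
        exact tsum_descendants_le hM hα fun K => a K L
    _ = 4 * ∑' K : M.descendants, (∑' L : N.descendants,
          ‖shiftCommutator α α' (fun K => a K L) K‖ₑ ^ 2) * ENNReal.ofReal (β' ^ 2) := by
        rw [ENNReal.tsum_mul_left, ENNReal.tsum_comm, mul_assoc, ENNReal.tsum_mul_right]
    _ ≤ _ := by
        refine mul_le_mul_right (ENNReal.tsum_le_tsum fun K => ?_) _
        exact tsum_descendants_le hN hβ fun L => shiftCommutator α α' (fun K => a K L) K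

/-! ### The BMO bound. -/

theorem rectSquareSum_le_tsum_descendants (b : ℝ × ℝ → 𝕜) {I₀ J₀ M N : DyadicInterval}
    (hM : I₀.toSet ⊆ M.toSet) (hN : J₀.toSet ⊆ N.toSet) :
    rectSquareSum b I₀ J₀ ≤
      ∑' K : M.descendants, ∑' L : N.descendants, ‖haarCoeff b (K, L)‖ₑ ^ 2 := by
  rw [rectSquareSum, ← ENNReal.tsum_prod
    (f := fun (K : M.descendants) (L : N.descendants) => ‖haarCoeff b (K, L)‖ₑ ^ 2)]
  let φ : {R : DyadicRect // R.1.toSet ⊆ I₀.toSet ∧ R.2.toSet ⊆ J₀.toSet} →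
      M.descendants × N.descendants := fun R =>
    (⟨R.1.1, DyadicInterval.mem_descendants_of_subset (R.2.1.trans hM)⟩,
      ⟨R.1.2, DyadicInterval.mem_descendants_of_subset (R.2.2.trans hN)⟩)
  have hφ : Function.Injective φ := by
    intro R Q h
    simp only [φ, Prod.mk.injEq, Subtype.mk.injEq] at h
    exact Subtype.ext (Prod.ext h.1 h.2)
  exact ENNReal.tsum_comp_le_tsum_of_injective hφ
    fun p : M.descendants × N.descendants => ‖haarCoeff b (p.1, p.2)‖ₑ ^ 2

theorem rectSquareSum_le {b : ℝ × ℝ → 𝕜}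
    {S : Lp 𝕜 2 (volume : Measure (ℝ × ℝ)) →L[𝕜] Lp 𝕜 2 (volume : Measure (ℝ × ℝ))}
    (hS : IsRepeatedCommutator b S) (I₀ J₀ : DyadicInterval) :
    rectSquareSum b I₀ J₀ ≤ 256 * ‖S‖ₑ ^ 2 * ENNReal.ofReal (I₀.length * J₀.length) := by
  obtain ⟨M, hM, hIM, hlM⟩ := I₀.exists_even_ancestor
  obtain ⟨N, hN, hJN, hlN⟩ := J₀.exists_even_ancestor
  have hEven : ∀ {K : DyadicInterval}, K.IsEven → K.parent.parent.IsEven := fun h => by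
    rw [DyadicInterval.isEven_parent_iff, DyadicInterval.isEven_parent_iff]
    exact not_not.2 h
  obtain ⟨α, hα, hcα⟩ := M.exists_haar_grandparent_eq
  obtain ⟨α', hα', hcα'⟩ := M.exists_shift_haar_eq
  obtain ⟨β, hβ, hcβ⟩ := N.exists_haar_grandparent_eq
  obtain ⟨β', hβ', hcβ'⟩ := N.exists_shift_haar_eq
  -- `T h_I` is made of Haar functions of the halves of `I`, normalized by half the length; hence
  -- `α'² = 2α²`.
  have hratio : ∀ K : DyadicInterval, K.parent.length⁻¹ = 2 * K.parent.parent.length⁻¹ := by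
    intro K
    rw [K.parent.length_parent]
    have := K.parent.length_pos
    field_simp
  have h1 := tsum_descendants_prod_le hM hN (α := α) (α' := α') (β := β) (β' := β')
    (by rw [hα, hα', hratio]) (by rw [hβ, hβ', hratio]) fun K L => haarCoeff b (K, L)
  set f := (memLp_haarSum (Finsupp.single (M.parent.parent, N.parent.parent) (1 : 𝕜))).toLp
    (haarSum (Finsupp.single (M.parent.parent, N.parent.parent) (1 : 𝕜))) with hf
  have h2 : ∑' K : M.descendants, ∑' L : N.descendants, ‖shiftCommutator β β'
      (fun L => shiftCommutator α α' (fun K => haarCoeff b (K, L)) K) L‖ₑ ^ 2 ≤ ‖S‖ₑ ^ 2 := by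
    calc _ = ∑' K : M.descendants, ∑' L : N.descendants, ‖haarCoeff (S f) (K, L)‖ₑ ^ 2 := by
          refine tsum_congr fun K => tsum_congr fun L => ?_
          rw [hS, repeatedCommutator_single hM hN (hEven hM) (hEven hN) hcα hcα' hcβ hcβ' K.2 L.2]
      _ = ∑' p : M.descendants × N.descendants, ‖haarCoeff (S f) (p.1, p.2)‖ₑ ^ 2 :=
          (ENNReal.tsum_prod
            (f := fun (K : M.descendants) (L : N.descendants) =>
              ‖haarCoeff (S f) (K, L)‖ₑ ^ 2)).symm
      _ ≤ ∑' R, ‖haarCoeff (S f) R‖ₑ ^ 2 :=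
          ENNReal.tsum_comp_le_tsum_of_injective
            (f := fun p : M.descendants × N.descendants =>
              ((p.1 : DyadicInterval), (p.2 : DyadicInterval)))
            (Subtype.val_injective.prodMap Subtype.val_injective)
            fun R => ‖haarCoeff (S f) R‖ₑ ^ 2
      _ ≤ ‖S f‖ₑ ^ 2 := tsum_haarCoeff_le _
      _ ≤ ‖S‖ₑ ^ 2 := by
          have hfn : ‖f‖ = 1 := norm_toLp_haarSum_single _
          have := S.le_opNorm f
          rw [hfn, mul_one] at this
          gcongr
          rw [← ofReal_norm, ← ofReal_norm]
          exact ENNReal.ofReal_le_ofReal this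
  have hpos : 0 < α' ^ 2 * β' ^ 2 := by
    rw [hα', hβ']
    exact mul_pos (inv_pos.2 M.parent.length_pos) (inv_pos.2 N.parent.length_pos)
  have h3 := (mul_le_mul_left (rectSquareSum_le_tsum_descendants b hIM hJN) _).trans
    (h1.trans (mul_le_mul_right h2 16))
  rw [← ENNReal.le_div_iff_mul_le (Or.inl (by simpa using hpos)) (Or.inl ENNReal.ofReal_ne_top),
    div_eq_mul_inv, ← ENNReal.ofReal_inv_of_pos hpos] at h3
  -- Passing to parents costs a factor 4 for the product of lengths, and replacing `M`, `N` by `I₀`,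
  -- `J₀` another 4.
  have hlen : (α' ^ 2 * β' ^ 2)⁻¹ ≤ 16 * (I₀.length * J₀.length) := by
    rw [hα', hβ', ← mul_inv, inv_inv, M.length_parent, N.length_parent]
    have := mul_le_mul hlM hlN N.length_pos.le (by linarith [I₀.length_pos])
    nlinarith
  refine h3.trans ((mul_le_mul_right (ENNReal.ofReal_le_ofReal hlen) _).trans_eq ?_)
  -- One 16 comes from the inversion in two variables, the other from the lengths.
  rw [ENNReal.ofReal_mul (by norm_num), ENNReal.ofReal_ofNat,
    show (256 : ℝ≥0∞) = 16 * 16 by norm_num]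
  ring

end Commutator

theorem theorem3p2 {𝕜 : Type*} [RCLike 𝕜] :
    (∀ b : ℝ × ℝ → 𝕜, LocallyIntegrable b volume →
      IsBoundedRepeatedCommutator b → MemRectBMO b) ∧
    ∃ C : ℝ≥0, ∀ b : ℝ × ℝ → 𝕜, LocallyIntegrable b volume →
      ∀ S : Lp 𝕜 2 (volume : Measure (ℝ × ℝ)) →L[𝕜] Lp 𝕜 2 (volume : Measure (ℝ × ℝ)),
        IsRepeatedCommutator b S → ∀ I₀ J₀ : DyadicInterval,
          rectSquareSum b I₀ J₀ ≤ C * ‖S‖ₑ ^ 2 * ENNReal.ofReal (I₀.length * J₀.length) := by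
  refine ⟨?_, 256, fun b _ S hS I₀ J₀ => by exact_mod_cast rectSquareSum_le hS I₀ J₀⟩
  rintro b - ⟨S, hS⟩
  refine ⟨256 * ‖S‖₊ ^ 2, fun I₀ J₀ => (rectSquareSum_le hS I₀ J₀).trans_eq ?_⟩
  rw [ENNReal.coe_mul, ENNReal.coe_pow]
  rfl

end
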